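/- For graphs $J$ and $G$ (all graphs are finite and simple) let $D_J(G)$ be the number of vertex sets $S\subseteq V(G)$ such that the induced subgraph $G[S]$ is isomorphic to $J$, and let $p_J(G)=D_J(G)/\binom{|V(G)|}{|V(J)|}$. Let $R(10,10)$ be the Ramsey number, that is, the least $n$ such that every graph on $n$ vertices contains a clique of size $10$ or an independent set of size $10$. There exists an $\epsilon>0$ such that for every graph $H$ on at least $R(10,10)$ vertices there is a sequence $(G_k)$ of graphs with $|V(G_k)|\to\infty$ as $k\to\infty$ such that no $G_k$ contains an induced copy of $H$, while for every graph $J$ on $4$ vertices the limit $\lim_{k\to\infty}p_J(G_k)$ exists and is greater than $\epsilon$. -/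

import Mathlib

open Filter Topology

/-- The Ramsey number `R(k, l)`: the least `n` such that every graph on `n` vertices contains a
clique of size `k` or an independent set of size `l`. -/
noncomputable def ramseyNumber (k l : ℕ) : ℕ :=
  sInf {n : ℕ | ∀ G : SimpleGraph (Fin n),
    (∃ s : Finset (Fin n), G.IsNClique k s) ∨ (∃ s : Finset (Fin n), G.IsNIndepSet l s)}

/-- `D_J(G)`: the number of induced copies of `J` in `G`, i.e. the number of vertex sets `S` of `G`
such that the induced subgraph `G[S]` is isomorphic to `J`. -/
noncomputable def inducedCopyCount {V W : Type*} (J : SimpleGraph W) (G : SimpleGraph V) : ℕ :=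
  {S : Finset V | Nonempty (G.induce (S : Set V) ≃g J)}.ncard

/-- `p_J(G)`: the induced density of `J` in `G`, i.e. `D_J(G)` divided by `|G|` choose `|J|`. -/
noncomputable def inducedDensity {V W : Type*} [Fintype V] [Fintype W]
    (J : SimpleGraph W) (G : SimpleGraph V) : ℝ :=
  (inducedCopyCount J G : ℝ) / ((Fintype.card V).choose (Fintype.card W) : ℝ)

/-! By Ramsey, `H` contains a 10-clique or an independent 10-set. Blowing up the disjoint union of
all graphs on 4 labelled vertices gives a 4-colorable, hence `K_5`-free, graph in which every
4-vertex graph has density bounded below (`exists_cliqueFree_inducedDensity_ge`). It omits `H` in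
the first case; its complement does in the second, and complementation only permutes the 4-vertex
graphs. Compactness supplies the limits. -/

namespace SimpleGraph

/-- **Ramsey's theorem** for graphs, relative to a large finite set of vertices. -/
theorem exists_isNClique_or_isNIndepSet_of_card_le (k l : ℕ) :
    ∃ n : ℕ, ∀ (V : Type) (G : SimpleGraph V) (s : Finset V), n ≤ s.card →
      (∃ t ⊆ s, G.IsNClique k t) ∨ (∃ t ⊆ s, G.IsNIndepSet l t) := by
  classical
  induction k generalizing l with
  | zero => exact ⟨0, fun V G s _ => .inl ⟨∅, by simp, by simp⟩⟩
  | succ k ihk =>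
    induction l with
    | zero => exact ⟨0, fun V G s _ => .inr ⟨∅, by simp, by rw [← isNClique_compl]; simp⟩⟩
    | succ l ihl =>
      obtain ⟨a, ha⟩ := ihk (l + 1)
      obtain ⟨b, hb⟩ := ihl
      -- Removing `v` leaves `a + b` vertices or more: at least `a` neighbours of `v` or at least
      -- `b` non-neighbours.
      refine ⟨a + b + 1, fun V G s hs => ?_⟩
      obtain ⟨v, hv⟩ : s.Nonempty := Finset.card_pos.1 (by omega)
      have hcard := Finset.card_filter_add_card_filter_not (s := s.erase v) (fun w => G.Adj v w)
      rw [Finset.card_erase_of_mem hv] at hcard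
      have hsub (p : V → Prop) [DecidablePred p] : (s.erase v).filter p ⊆ s :=
        (Finset.filter_subset _ _).trans (Finset.erase_subset _ _)
      rcases le_or_gt a ((s.erase v).filter fun w => G.Adj v w).card with h | h
      · rcases ha V G _ h with ⟨t, hts, ht⟩ | ⟨t, hts, ht⟩
        · refine .inl ⟨insert v t, Finset.insert_subset hv (hts.trans (hsub _)),
            ht.insert fun w hw => (Finset.mem_filter.1 (hts hw)).2⟩
        · exact .inr ⟨t, hts.trans (hsub _), ht⟩
      · rcases hb V G ((s.erase v).filter fun w => ¬ G.Adj v w) (by omega) with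
          ⟨t, hts, ht⟩ | ⟨t, hts, ht⟩
        · exact .inl ⟨t, hts.trans (hsub _), ht⟩
        · refine .inr ⟨insert v t, Finset.insert_subset hv (hts.trans (hsub _)), ?_⟩
          rw [← isNClique_compl] at ht ⊢
          refine ht.insert fun w hw => ?_
          have hw' := Finset.mem_filter.1 (hts hw)
          exact (G.compl_adj v w).2 ⟨(Finset.ne_of_mem_erase hw'.1).symm, hw'.2⟩

/-- A graph on at least `ramseyNumber k l` vertices has a `k`-clique or its complement has an
`l`-clique. -/
theorem not_cliqueFree_or_not_cliqueFree_compl {k l m : ℕ} (hm : ramseyNumber k l ≤ m)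
    (H : SimpleGraph (Fin m)) : ¬ H.CliqueFree k ∨ ¬ Hᶜ.CliqueFree l := by
  have hR : ramseyNumber k l ∈ {n : ℕ | ∀ G : SimpleGraph (Fin n),
      (∃ s : Finset (Fin n), G.IsNClique k s) ∨ (∃ s : Finset (Fin n), G.IsNIndepSet l s)} := by
    -- The infimum is attained only if the set is nonempty (`sInf ∅ = 0`), hence the need for
    -- Ramsey's theorem.
    refine Nat.sInf_mem ?_
    obtain ⟨n, hn⟩ := exists_isNClique_or_isNIndepSet_of_card_le k l
    refine ⟨n, fun G => ?_⟩
    exact (hn _ G Finset.univ (by simp)).imp (fun ⟨t, _, ht⟩ => ⟨t, ht⟩) fun ⟨t, _, ht⟩ => ⟨t, ht⟩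
  let e : H.comap (Fin.castLEEmb hm) ↪g H := Embedding.comap _ H
  refine (hR (H.comap (Fin.castLEEmb hm))).imp (fun ⟨s, hs⟩ h => ?_) fun ⟨s, hs⟩ h => ?_
  · exact h.comap e.isContained s hs
  · exact h.comap (Embedding.complEquiv e).isContained s ((isNClique_compl _).2 hs)

end SimpleGraph

open SimpleGraph

section InducedCount

variable {V W : Type*}

theorem inducedCopyCount_compl (J : SimpleGraph W) (G : SimpleGraph V) :
    inducedCopyCount Jᶜ Gᶜ = inducedCopyCount J G := by
  unfold inducedCopyCount
  congr 1
  ext S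
  constructor
  · rintro ⟨e⟩
    refine ⟨⟨e.toEquiv, fun {a b} => ?_⟩⟩
    have h := e.map_adj_iff (v := a) (w := b)
    by_cases hab : a = b
    · simp [hab]
    · have : (a : V) ≠ b := fun h => hab (Subtype.ext h)
      simp only [compl_adj, comap_adj, Function.Embedding.subtype_apply, ne_eq,
        EmbeddingLike.apply_eq_iff_eq, hab, this, not_false_eq_true, true_and] at h
      exact not_iff_not.1 h
  · rintro ⟨e⟩
    refine ⟨⟨e.toEquiv, fun {a b} => ?_⟩⟩
    have h := e.map_adj_iff (v := a) (w := b)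
    by_cases hab : a = b
    · simp [hab]
    · have : (a : V) ≠ b := fun h => hab (Subtype.ext h)
      simp only [compl_adj, comap_adj, Function.Embedding.subtype_apply, ne_eq,
        EmbeddingLike.apply_eq_iff_eq, hab, this, not_false_eq_true, true_and]
      exact not_congr h

theorem inducedDensity_compl [Fintype V] [Fintype W] (J : SimpleGraph W) (G : SimpleGraph V) :
    inducedDensity Jᶜ Gᶜ = inducedDensity J G := by
  simp only [inducedDensity, inducedCopyCount_compl]

theorem inducedCopyCount_le_choose [Fintype V] [Fintype W] (J : SimpleGraph W)
    (G : SimpleGraph V) :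
    inducedCopyCount J G ≤ (Fintype.card V).choose (Fintype.card W) := by
  classical
  rw [← Finset.card_univ (α := V), ← Finset.card_powersetCard, ← Set.ncard_coe_finset]
  refine Set.ncard_le_ncard ?_ (Set.toFinite _)
  rintro S ⟨e⟩
  have := Fintype.card_congr e.toEquiv
  simpa using this

theorem inducedDensity_mem_Icc [Fintype V] [Fintype W] (J : SimpleGraph W) (G : SimpleGraph V) :
    inducedDensity J G ∈ Set.Icc (0 : ℝ) 1 :=
  ⟨by unfold inducedDensity; positivity,
    div_le_one_of_le₀ (by exact_mod_cast inducedCopyCount_le_choose J G) (by positivity)⟩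

theorem card_le_inducedCopyCount [Finite V] [Finite W] {ι : Type*} {J : SimpleGraph W}
    {G : SimpleGraph V} (φ : ι → (J ↪g G)) (hφ : Function.Injective fun i => Set.range (φ i)) :
    Nat.card ι ≤ inducedCopyCount J G := by
  classical
  have := Fintype.ofFinite V
  let f : ι → Finset V := fun i => (Set.range (φ i)).toFinset
  have hf : Function.Injective f := fun i j h => hφ (Set.toFinset_inj.1 h)
  rw [← Nat.card_range_of_injective hf, Nat.card_coe_set_eq]
  refine Set.ncard_le_ncard ?_ (Set.toFinite _)
  rintro _ ⟨i, rfl⟩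
  have h : ((f i : Finset V) : Set V) = Set.range (φ i) := Set.coe_toFinset _
  change Nonempty (G.induce (f i : Set V) ≃g J)
  rw [h]
  exact ⟨(φ i).isoInduceRange.symm⟩

end InducedCount

/-- The blow-up, with independent parts of size `k`, of the disjoint union of all graphs on the
vertex set `W`. -/
def universalBlowup (W : Type*) (k : ℕ) : SimpleGraph ((SimpleGraph W × W) × Fin k) where
  Adj x y := x.1.1 = y.1.1 ∧ x.1.1.Adj x.1.2 y.1.2
  symm := ⟨fun _ _ h => ⟨h.1.symm, h.1 ▸ h.2.symm⟩⟩
  loopless := ⟨fun _ h => h.2.ne rfl⟩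

/-- The transversal copy of `J` in the blow-up given by a choice of one vertex in each part. -/
def universalBlowupEmbedding {W : Type*} {k : ℕ} (J : SimpleGraph W) (a : W → Fin k) :
    J ↪g universalBlowup W k where
  toFun i := ((J, i), a i)
  inj' i j h := by simpa using congrArg (fun x => x.1.2) h
  map_rel_iff' := ⟨fun h => h.2, fun h => ⟨rfl, h⟩⟩

theorem universalBlowup_colorable (W : Type*) [Fintype W] (k : ℕ) :
    (universalBlowup W k).Colorable (Fintype.card W) :=
  (Coloring.mk (fun x => x.1.2) fun h => h.2.ne : (universalBlowup W k).Coloring W).colorable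

/-- Each `J` has `k ^ w` transversal copies, against at most `(M * k) ^ w` vertex sets, so the bound
does not depend on `k`. -/
theorem exists_cliqueFree_inducedDensity_ge (w : ℕ) (hw : 0 < w) :
    ∃ M : ℕ, 0 < M ∧ ∀ k, 0 < k → ∃ G : SimpleGraph (Fin (M * k)), G.CliqueFree (w + 1) ∧
      ∀ J : SimpleGraph (Fin w), 1 / (M : ℝ) ^ w ≤ inducedDensity J G := by
  obtain ⟨M, hM⟩ : ∃ M, M = Nat.card (SimpleGraph (Fin w)) * w := ⟨_, rfl⟩
  have hwM : w ≤ M := hM ▸ Nat.le_mul_of_pos_left _ Nat.card_pos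
  have hM0 : 0 < M := hw.trans_le hwM
  refine ⟨M, hM0, fun k hk => ?_⟩
  let e : Fin (M * k) ≃ (SimpleGraph (Fin w) × Fin w) × Fin k :=
    (Finite.equivFinOfCardEq (by simp [hM])).symm
  let i := Iso.comap e (universalBlowup (Fin w) k)
  refine ⟨(universalBlowup (Fin w) k).comap e, ?_, fun J => ?_⟩
  · exact CliqueFree.comap i.isContained
      ((universalBlowup_colorable (Fin w) k).cliqueFree (by simp))
  · have hcount : k ^ w ≤ inducedCopyCount J ((universalBlowup (Fin w) k).comap e) := by
      have := card_le_inducedCopyCount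
        (fun a : Fin w → Fin k => i.symm.toEmbedding.comp (universalBlowupEmbedding J a)) ?_
      · simpa using this
      · intro a b hab
        funext j
        -- A transversal meets part `j` only in `a j`, so its vertex set determines `a`.
        have hj : e.symm ((J, j), a j) ∈
            Set.range (i.symm.toEmbedding.comp (universalBlowupEmbedding J b)) :=
          (Set.ext_iff.1 hab _).1 ⟨j, rfl⟩
        obtain ⟨j', hj'⟩ := hj
        have h : ((J, j'), b j') = ((J, j), a j) := e.symm.injective hj'
        obtain rfl : j' = j := congrArg (fun x => x.1.2) h
        exact (congrArg Prod.snd h).symm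
    have hchoose : (M * k).choose w ≤ M ^ w * k ^ w := by
      rw [← mul_pow]; exact Nat.choose_le_pow _ _
    have hpos : 0 < (M * k).choose w :=
      Nat.choose_pos (hwM.trans (Nat.le_mul_of_pos_right _ hk))
    unfold inducedDensity
    simp only [Fintype.card_fin]
    rw [div_le_div_iff₀ (by positivity) (by exact_mod_cast hpos), one_mul]
    calc (((M * k).choose w : ℕ) : ℝ) ≤ (M ^ w * k ^ w : ℕ) := by exact_mod_cast hchoose
      _ = (k ^ w : ℕ) * (M : ℝ) ^ w := by push_cast; ring
      _ ≤ _ := by gcongr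

/-- One subsequence serves all `J` at once, by compactness of the cube of density vectors. -/
theorem exists_subseq_tendsto_inducedDensity {W : Type*} [Fintype W] (n : ℕ → ℕ)
    (G : (k : ℕ) → SimpleGraph (Fin (n k))) :
    ∃ φ : ℕ → ℕ, StrictMono φ ∧ ∀ J : SimpleGraph W, ∃ p : ℝ,
      Tendsto (fun k => inducedDensity J (G (φ k))) atTop (𝓝 p) := by
  have hc : IsCompact (Set.univ.pi fun _ : SimpleGraph W => Set.Icc (0 : ℝ) 1) :=
    isCompact_univ_pi fun _ => isCompact_Icc
  obtain ⟨p, -, φ, hφ, h⟩ := hc.tendsto_subseq (x := fun k J => inducedDensity J (G k))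
    fun k J _ => inducedDensity_mem_Icc J (G k)
  exact ⟨φ, hφ, fun J => ⟨p J, tendsto_pi_nhds.1 h J⟩⟩

theorem mainTheorem4 :
    ∃ ε : ℝ, 0 < ε ∧
      ∀ (m : ℕ), ramseyNumber 10 10 ≤ m → ∀ H : SimpleGraph (Fin m),
        ∃ (n : ℕ → ℕ) (G : (k : ℕ) → SimpleGraph (Fin (n k))),
          Tendsto n atTop atTop ∧
          (∀ k, ¬ H.IsIndContained (G k)) ∧
          ∀ J : SimpleGraph (Fin 4), ∃ p : ℝ,
            Tendsto (fun k => inducedDensity J (G k)) atTop (𝓝 p) ∧ ε < p := by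
  obtain ⟨M, hM, hB⟩ := exists_cliqueFree_inducedDensity_ge 4 (by norm_num)
  choose B hfree hdens using fun k : ℕ => hB (k + 1) k.succ_pos
  have hε : 0 < 1 / (M : ℝ) ^ 4 := by positivity
  -- Limits preserve only `≤`; halving makes the bound strict.
  refine ⟨1 / (M : ℝ) ^ 4 / 2, half_pos hε, fun m hm H => ?_⟩
  obtain ⟨G, hH, hG⟩ : ∃ G : (k : ℕ) → SimpleGraph (Fin (M * (k + 1))),
      (∀ k, ¬ H.IsIndContained (G k)) ∧ ∀ k J, 1 / (M : ℝ) ^ 4 ≤ inducedDensity J (G k) := by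
    rcases not_cliqueFree_or_not_cliqueFree_compl hm H with h | h
    · exact ⟨B, fun k hk => h (((hfree k).mono (by norm_num)).comap hk.isContained), hdens⟩
    · refine ⟨fun k => (B k)ᶜ, fun k hk => h (((hfree k).mono (by norm_num)).comap ?_),
        fun k J => ?_⟩
      · simpa using hk.compl.isContained
      · rw [← compl_compl J, inducedDensity_compl]
        exact hdens k Jᶜ
  obtain ⟨φ, hφ, hlim⟩ := exists_subseq_tendsto_inducedDensity (W := Fin 4) _ G
  refine ⟨fun k => M * (φ k + 1), fun k => G (φ k), ?_, fun k => hH _, fun J => ?_⟩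
  · refine tendsto_atTop_mono (fun k => ?_) hφ.tendsto_atTop
    exact (Nat.le_succ _).trans (Nat.le_mul_of_pos_left _ hM)
  · obtain ⟨p, hp⟩ := hlim J
    exact ⟨p, hp, (half_lt_self hε).trans_le (ge_of_tendsto' hp fun k => hG _ J)⟩
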